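/- A frame $L$ is a complete lattice satisfying $a\wedge\bigvee S=\bigvee\{a\wedge s: s\in S\}$ for all $a\in L$, $S\subseteq L$ (hence a complete Heyting algebra); $K(L)$ is its set of compact elements. A *Heyting frame* is a frame $L$ in which every element is a join of compact elements and $K(L)$ is a Heyting subalgebra of $L$ (it contains $0,1$ and is closed under $\wedge,\vee,\to$). An *Esakia space* is a Priestley space (a compact ordered space in which, for $x\not\le y$, some clopen upset contains $x$ but not $y$) in which ${\downarrow}U$ is clopen for each clopen $U$. A *Priestley morphism* is a continuous order-preserving map. For a Priestley space $X$ let $\mathsf{OpUp}(X)$ be the complete lattice of open upsets of $X$, ordered by inclusion. For a bounded lattice homomorphism $h:A\to B$ between Heyting algebras let $h^*$ be the map $I\mapsto{\downarrow}h[I]$ from the ideals of $A$ to the ideals of $B$. Consider the following categories. - $\mathsf{HeytFrm}^*$: Heyting frames and complete lattice homomorphisms (preserving arbitrary joins and meets) that send compact elements to compact elements. - $\mathsf{HA}^*$: Heyting algebras and bounded lattice homomorphisms $h$ (not required to preserve implication) such that $h^*$ is a complete lattice homomorphism. - $\mathsf{ES}^*$: Esakia spaces and Priestley morphisms $f:X\to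 Y$ such that $f^{-1}({\downarrow}\,\mathsf{cl}\,D)={\downarrow}\,\mathsf{cl}\,f^{-1}(D)$ for every downset $D$ of $Y$. Then: 1. $\mathsf{HeytFrm}^*$ is equivalent to $\mathsf{HA}^*$, via a functor naturally isomorphic to $L\mapsto K(L)$, $\alpha\mapsto\alpha|_{K(L)}$. 2. $\mathsf{HeytFrm}^*$ is dually equivalent to $\mathsf{ES}^*$, via a contravariant functor naturally isomorphic to $X\mapsto\mathsf{OpUp}(X)$, $f\mapsto f^{-1}$. 3. For every Priestley morphism $f:X\to Y$ between Priestley spaces, $f^{-1}:\mathsf{OpUp}(Y)\to\mathsf{OpUp}(X)$ preserves arbitrary meets if and only if $f^{-1}({\downarrow}\,\mathsf{cl}\,D)={\downarrow}\,\mathsf{cl}\,f^{-1}(D)$ for every downset $D$ of $Y$. -/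

import Mathlib

open CategoryTheory

universe u v w

/-! ### Heyting frames and `HeytFrm*` -/

/-- A Heyting frame: a coherent frame `L` (every element is a join of compact elements, and the
compact elements form a bounded sublattice) whose compact elements form a Heyting subalgebra
of `L`. -/
structure IsHeytingFrame (L : Type u) [Order.Frame L] : Prop where
  algebraic : IsCompactlyGenerated L
  bot_mem : IsCompactElement (⊥ : L)
  top_mem : IsCompactElement (⊤ : L)
  sup_mem : ∀ a b : L, IsCompactElement a → IsCompactElement b → IsCompactElement (a ⊔ b)
  inf_mem : ∀ a b : L, IsCompactElement a → IsCompactElement b → IsCompactElement (a ⊓ b)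
  himp_mem : ∀ a b : L, IsCompactElement a → IsCompactElement b → IsCompactElement (a ⇨ b)

/-- Objects of `HeytFrm*`: Heyting frames. -/
structure HeytFrmStar where
  carrier : Type u
  [frame : Order.Frame carrier]
  isHeytingFrame : IsHeytingFrame carrier

namespace HeytFrmStar

instance : CoeSort HeytFrmStar.{u} (Type u) := ⟨carrier⟩

instance (L : HeytFrmStar.{u}) : Order.Frame L := L.frame

/-- Morphisms of `HeytFrm*`: maps preserving arbitrary joins, arbitrary meets, and
compact elements. -/
@[ext]
structure Hom (L M : HeytFrmStar.{u}) where
  hom : CompleteLatticeHom L M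
  map_compact : ∀ a : L, IsCompactElement a → IsCompactElement (hom a)

instance : Category HeytFrmStar.{u} where
  Hom L M := Hom L M
  id L := ⟨CompleteLatticeHom.id L, fun _ ha => ha⟩
  comp α β := ⟨β.hom.comp α.hom, fun a ha => β.map_compact _ (α.map_compact a ha)⟩

end HeytFrmStar

/-! ### Ideals and `HA*` -/

/-- For a bounded lattice homomorphism `h : A → B`, the map `h* : I ↦ ↓h[I]` from ideals of `A`
to ideals of `B`. -/
def idealMap {A : Type u} {B : Type v} [HeytingAlgebra A] [HeytingAlgebra B]
    (h : BoundedLatticeHom A B) (I : Order.Ideal A) : Order.Ideal B where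
  carrier := {b | ∃ a ∈ I, b ≤ h a}
  lower' := fun _ _ hcb ⟨a, ha, hb⟩ => ⟨a, ha, hcb.trans hb⟩
  nonempty' := ⟨⊥, ⊥, I.bot_mem, bot_le⟩
  directed' := by
    rintro b ⟨a, ha, hb⟩ c ⟨a', ha', hc⟩
    refine ⟨h (a ⊔ a'), ⟨a ⊔ a', I.sup_mem ha ha', le_rfl⟩, ?_, ?_⟩
    · exact hb.trans (OrderHomClass.mono h le_sup_left)
    · exact hc.trans (OrderHomClass.mono h le_sup_right)

theorem idealMap_id {A : Type u} [HeytingAlgebra A] (I : Order.Ideal A) :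
    idealMap (BoundedLatticeHom.id A) I = I := by
  ext b
  exact ⟨fun ⟨_, ha, hb⟩ => I.lower hb ha, fun hb => ⟨b, hb, le_rfl⟩⟩

theorem idealMap_comp {A : Type u} {B : Type v} {C : Type w} [HeytingAlgebra A]
    [HeytingAlgebra B] [HeytingAlgebra C] (g : BoundedLatticeHom B C)
    (h : BoundedLatticeHom A B) (I : Order.Ideal A) :
    idealMap (g.comp h) I = idealMap g (idealMap h I) := by
  ext c
  constructor
  · rintro ⟨a, ha, hc⟩
    exact ⟨h a, ⟨a, ha, le_rfl⟩, hc⟩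
  · rintro ⟨b, ⟨a, ha, hb⟩, hc⟩
    exact ⟨a, ha, hc.trans (OrderHomClass.mono g hb)⟩

/-- Objects of `HA*`: Heyting algebras. -/
structure HAStar where
  carrier : Type u
  [heyting : HeytingAlgebra carrier]

namespace HAStar

instance : CoeSort HAStar.{u} (Type u) := ⟨carrier⟩

instance (A : HAStar.{u}) : HeytingAlgebra A := A.heyting

/-- Morphisms of `HA*`: bounded lattice homomorphisms `h` (not required to preserve implication)
such that `h*` is a complete lattice homomorphism between the ideal lattices. -/
@[ext]
structure Hom (A B : HAStar.{u}) where
  hom : BoundedLatticeHom A B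
  map_sSup : ∀ S : Set (Order.Ideal A), idealMap hom (sSup S) = sSup (idealMap hom '' S)
  map_sInf : ∀ S : Set (Order.Ideal A), idealMap hom (sInf S) = sInf (idealMap hom '' S)

instance : Category HAStar.{u} where
  Hom A B := Hom A B
  id A :=
    { hom := BoundedLatticeHom.id A
      map_sSup := fun S => by simp [idealMap_id]
      map_sInf := fun S => by simp [idealMap_id] }
  comp h g :=
    { hom := g.hom.comp h.hom
      map_sSup := fun S => by
        simp only [idealMap_comp, h.map_sSup, g.map_sSup, Set.image_image]
      map_sInf := fun S => by
        simp only [idealMap_comp, h.map_sInf, g.map_sInf, Set.image_image] }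

end HAStar

/-! ### Esakia spaces and `ES*` -/

/-- The condition `f⁻¹(↓ cl D) = ↓ cl f⁻¹(D)` for all downsets `D`. -/
def PreservesDownClosure {X : Type u} {Y : Type v} [PartialOrder X] [TopologicalSpace X]
    [PartialOrder Y] [TopologicalSpace Y] (f : X → Y) : Prop :=
  ∀ D : Set Y, IsLowerSet D →
    f ⁻¹' (lowerClosure (closure D) : Set Y) = (lowerClosure (closure (f ⁻¹' D)) : Set X)

/-- Objects of `ES*`: Esakia spaces, i.e. Priestley spaces (compact, with the Priestley separation
axiom) in which the downset of every clopen set is clopen. -/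
structure ESStar where
  carrier : Type u
  [order : PartialOrder carrier]
  [top : TopologicalSpace carrier]
  [compact : CompactSpace carrier]
  [priestley : PriestleySpace carrier]
  isClopen_lowerClosure : ∀ U : Set carrier, IsClopen U → IsClopen (lowerClosure U : Set carrier)

namespace ESStar

instance : CoeSort ESStar.{u} (Type u) := ⟨carrier⟩

instance (X : ESStar.{u}) : PartialOrder X := X.order
instance (X : ESStar.{u}) : TopologicalSpace X := X.top
instance (X : ESStar.{u}) : CompactSpace X := X.compact
instance (X : ESStar.{u}) : PriestleySpace X := X.priestley

/-- Morphisms of `ES*`: Priestley morphisms (continuous order-preserving maps) `f` with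
`f⁻¹(↓ cl D) = ↓ cl f⁻¹(D)` for all downsets `D`. -/
@[ext]
structure Hom (X Y : ESStar.{u}) where
  hom : X →Co Y
  preserves : PreservesDownClosure hom

instance : Category ESStar.{u} where
  Hom X Y := Hom X Y
  id X := ⟨ContinuousOrderHom.id X, fun _ _ => rfl⟩
  comp f g := ⟨g.hom.comp f.hom, fun D hD => by
    have h := f.preserves (g.hom ⁻¹' D) (hD.preimage (OrderHomClass.mono g.hom))
    rw [← g.preserves D hD] at h
    exact h⟩

end ESStar

/-! ### Open upsets -/

/-- The open upsets of an ordered topological space. -/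
def OpUp (X : Type u) [PartialOrder X] [TopologicalSpace X] : Type u :=
  {U : Set X // IsOpen U ∧ IsUpperSet U}

namespace OpUp

/-- Open upsets are ordered by inclusion. -/
instance (X : Type u) [PartialOrder X] [TopologicalSpace X] : PartialOrder (OpUp X) :=
  inferInstanceAs (PartialOrder {U : Set X // IsOpen U ∧ IsUpperSet U})

/-- Arbitrary joins are unions; the meet of a family is the largest open upset contained in all
its members. -/
instance (X : Type u) [PartialOrder X] [TopologicalSpace X] : SupSet (OpUp X) :=
  ⟨fun S => ⟨⋃ U ∈ S, U.1, isOpen_biUnion fun (U : OpUp X) _ => U.2.1,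
    isUpperSet_iUnion₂ fun (U : OpUp X) _ => U.2.2⟩⟩

instance (X : Type u) [PartialOrder X] [TopologicalSpace X] : CompleteLattice (OpUp X) :=
  completeLatticeOfSup (OpUp X) fun _ =>
    ⟨fun _ hU => Set.subset_biUnion_of_mem (u := fun V : OpUp X => V.1) hU,
      fun _ hV => Set.iUnion₂_subset fun _ hU => hV hU⟩

/-- The map `f⁻¹ : OpUp(Y) → OpUp(X)` of a continuous order-preserving map `f : X → Y`. -/
def preimage {X : Type u} {Y : Type v} [PartialOrder X] [TopologicalSpace X]
    [PartialOrder Y] [TopologicalSpace Y] (f : X →Co Y) (U : OpUp Y) : OpUp X :=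
  ⟨f ⁻¹' U.1, U.2.1.preimage (map_continuous f), U.2.2.preimage (OrderHomClass.mono f)⟩

end OpUp

/-! ### The frame of ideals of a Heyting algebra -/

/-! Two representations carry the proof. Algebraically, the ideals of a Heyting algebra `A` form a
Heyting frame whose compact elements are the principal ideals, a copy of `A`; conversely a Heyting
frame `L` is the ideal frame of its compact elements (`idealOrderIso`). Under this identification a
morphism `α` becomes `h*` for its restriction `h` (`idealOrderIso_idealMap`), so the condition
defining `HA*` says exactly that `h` extends to a complete lattice homomorphism.

Topologically, the compact open upsets of a Priestley space are the clopen ones, and the Esakia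
condition keeps them closed under implication, since `U ⇨ V` is the complement of `↓(U \ V)`. The
meet of a family of open upsets is the complement of `↓ cl D`, where `D` is the complement of the
intersection (`coe_sInf`). Every downset occurs as such a `D`, which gives the third claim
(`preimage_sInf_iff`). Fullness of the open upset functor rests on recovering points from
homomorphisms (`exists_point`), and essential surjectivity on matching ideals of `A` with open
upsets of its prime filter space (`idealOrderIsoOpUp`). -/

section Ideals

open Order

variable {A : Type u} [HeytingAlgebra A]

/-- The relative pseudocomplement `{a | ∀ i ∈ I, a ⊓ i ∈ J}` of ideals. -/
def idealHimp (I J : Ideal A) : Ideal A where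
  carrier := {a | ∀ i ∈ I, a ⊓ i ∈ J}
  lower' := fun _ _ hba ha i hi => J.lower (inf_le_inf_right i hba) (ha i hi)
  nonempty' := ⟨⊥, fun i _ => by simp⟩
  directed' := fun a ha b hb => ⟨a ⊔ b, fun i hi => by
    rw [inf_sup_right]; exact J.sup_mem (ha i hi) (hb i hi), le_sup_left, le_sup_right⟩

theorem le_idealHimp_iff {I J K : Ideal A} : K ≤ idealHimp I J ↔ K ⊓ I ≤ J := by
  constructor
  · rintro h a ⟨haK, haI⟩
    simpa using h haK a haI
  · intro h a ha i hi
    exact h ⟨K.lower inf_le_left ha, I.lower inf_le_right hi⟩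

instance idealFrame : Order.Frame (Ideal A) where
  __ := (inferInstance : CompleteLattice (Ideal A))
  himp := idealHimp
  le_himp_iff _ _ _ := le_idealHimp_iff
  compl I := idealHimp I ⊥
  himp_bot _ := rfl

/-- The union of a directed nonempty family of ideals is an ideal, hence bounds the join; an element
of the join then lies in a single member. -/
theorem isCompactElement_principal (a : A) : IsCompactElement (Ideal.principal a) := by
  intro s u hs hd hu hau
  have hI : IsIdeal (⋃₀ ((fun I : Ideal A => (I : Set A)) '' s)) := by
    apply isIdeal_sUnion_of_directedOn
    · rintro _ ⟨I, _, rfl⟩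
      exact I.isIdeal
    · rintro _ ⟨I, hI, rfl⟩ _ ⟨J, hJ, rfl⟩
      obtain ⟨K, hK, h⟩ := hd I hI J hJ
      exact ⟨K, ⟨K, hK, rfl⟩, h⟩
    · exact hs.image _
  have hle : u ≤ hI.toIdeal := hu.2 fun I hI b hb => ⟨I, ⟨I, hI, rfl⟩, hb⟩
  obtain ⟨_, ⟨I, hIs, rfl⟩, ha⟩ := hle (Ideal.principal_le_iff.1 hau)
  exact ⟨I, hIs, Ideal.principal_le_iff.2 ha⟩

theorem isLUB_principal_image (I : Ideal A) : IsLUB (Ideal.principal '' (I : Set A)) I := by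
  constructor
  · rintro _ ⟨a, ha, rfl⟩
    exact Ideal.principal_le_iff.2 ha
  · intro J hJ a ha
    exact Ideal.principal_le_iff.1 (hJ ⟨a, ha, rfl⟩)

/-- An ideal is the directed join of the principal ideals it contains, so compactness makes it one
of them. -/
theorem isCompactElement_ideal_iff {I : Ideal A} :
    IsCompactElement I ↔ ∃ a, Ideal.principal a = I := by
  constructor
  · intro h
    obtain ⟨_, ⟨a, ha, rfl⟩, hI⟩ := h _ I (I.nonempty.image _)
      (by
        rintro _ ⟨a, ha, rfl⟩ _ ⟨b, hb, rfl⟩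
        exact ⟨_, ⟨a ⊔ b, I.sup_mem ha hb, rfl⟩, by simp, by simp⟩)
      (isLUB_principal_image I) le_rfl
    exact ⟨a, le_antisymm (Ideal.principal_le_iff.2 ha) hI⟩
  · rintro ⟨a, rfl⟩
    exact isCompactElement_principal a

theorem principal_sup_principal (a b : A) :
    Ideal.principal a ⊔ Ideal.principal b = Ideal.principal (a ⊔ b) := by
  apply le_antisymm
  · simp
  · exact Ideal.principal_le_iff.2 ⟨a, le_rfl, b, le_rfl, le_rfl⟩

theorem principal_inf_principal (a b : A) :
    Ideal.principal a ⊓ Ideal.principal b = Ideal.principal (a ⊓ b) := by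
  ext x
  exact le_inf_iff.symm

theorem principal_himp_principal (a b : A) :
    Ideal.principal a ⇨ Ideal.principal b = Ideal.principal (a ⇨ b) := by
  apply le_antisymm
  · intro x hx
    exact le_himp_iff.2 (hx a le_rfl)
  · rw [le_himp_iff, principal_inf_principal]
    simp

theorem isHeytingFrame_ideal (A : Type u) [HeytingAlgebra A] : IsHeytingFrame (Ideal A) where
  algebraic := ⟨fun I => ⟨Ideal.principal '' (I : Set A), by
    rintro _ ⟨a, _, rfl⟩
    exact isCompactElement_principal a, (isLUB_principal_image I).sSup_eq⟩⟩
  bot_mem := isCompactElement_ideal_iff.2 ⟨⊥, Ideal.principal_bot⟩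
  top_mem := isCompactElement_ideal_iff.2 ⟨⊤, Ideal.principal_top⟩
  sup_mem := by
    simp only [isCompactElement_ideal_iff]
    rintro _ _ ⟨a, rfl⟩ ⟨b, rfl⟩
    exact ⟨_, (principal_sup_principal a b).symm⟩
  inf_mem := by
    simp only [isCompactElement_ideal_iff]
    rintro _ _ ⟨a, rfl⟩ ⟨b, rfl⟩
    exact ⟨_, (principal_inf_principal a b).symm⟩
  himp_mem := by
    simp only [isCompactElement_ideal_iff]
    rintro _ _ ⟨a, rfl⟩ ⟨b, rfl⟩
    exact ⟨_, (principal_himp_principal a b).symm⟩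

/-- A Heyting algebra is isomorphic to the compact elements of its ideal frame. -/
noncomputable def principalOrderIso (A : Type u) [HeytingAlgebra A] :
    A ≃o {I : Ideal A // IsCompactElement I} :=
  OrderIso.ofSurjective
    (OrderEmbedding.ofMapLEIff (fun a => ⟨Ideal.principal a, isCompactElement_principal a⟩)
      fun a b => by simp [← Subtype.coe_le_coe])
    fun ⟨I, hI⟩ => by
      obtain ⟨a, rfl⟩ := isCompactElement_ideal_iff.1 hI
      exact ⟨a, rfl⟩

end Ideals

theorem IsCompactElement.map_orderIso {α : Type u} {β : Type v} [PartialOrder α] [PartialOrder β]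
    {a : α} (ha : IsCompactElement a) (e : α ≃o β) : IsCompactElement (e a) := by
  intro s u hs hd hu hau
  obtain ⟨x, hx, hax⟩ := ha (e ⁻¹' s) (e.symm u) (hs.preimage e.surjective)
    (fun x hx y hy => by
      obtain ⟨z, hz, hxz, hyz⟩ := hd _ hx _ hy
      exact ⟨e.symm z, by simpa using hz, by simpa [e.le_symm_apply] using hxz,
        by simpa [e.le_symm_apply] using hyz⟩)
    (e.isLUB_preimage.2 (by simpa using hu)) (e.le_symm_apply.2 hau)
  exact ⟨e x, hx, e.monotone hax⟩

/-! ### Heyting frames and their compact elements -/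

namespace HeytFrmStar

/-- The Heyting frame of ideals of a Heyting algebra. -/
def ofIdeals (A : Type u) [HeytingAlgebra A] : HeytFrmStar.{u} :=
  ⟨Order.Ideal A, isHeytingFrame_ideal A⟩

variable {L M : HeytFrmStar.{u}}

/-- Order isomorphisms of Heyting frames are isomorphisms in `HeytFrm*`. -/
def isoOfOrderIso (e : L ≃o M) : L ≅ M where
  hom := ⟨(e : CompleteLatticeHom L M), fun _ ha => ha.map_orderIso e⟩
  inv := ⟨(e.symm : CompleteLatticeHom M L), fun _ ha => ha.map_orderIso e.symm⟩
  hom_inv_id := Hom.ext (DFunLike.ext _ _ fun a => e.symm_apply_apply a)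
  inv_hom_id := Hom.ext (DFunLike.ext _ _ fun a => e.apply_symm_apply a)

instance compactHeyting (L : HeytFrmStar.{u}) : HeytingAlgebra {a : L // IsCompactElement a} where
  __ := Subtype.lattice (fun {a b} ha hb => L.isHeytingFrame.sup_mem a b ha hb)
    (fun {a b} ha hb => L.isHeytingFrame.inf_mem a b ha hb)
  top := ⟨⊤, L.isHeytingFrame.top_mem⟩
  le_top _ := Subtype.coe_le_coe.1 le_top
  bot := ⟨⊥, L.isHeytingFrame.bot_mem⟩
  bot_le _ := Subtype.coe_le_coe.1 bot_le
  himp a b := ⟨a ⇨ b, L.isHeytingFrame.himp_mem a b a.2 b.2⟩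
  le_himp_iff _ b _ := le_himp_iff (b := (b : L))
  compl a := ⟨a ⇨ ⊥, L.isHeytingFrame.himp_mem a ⊥ a.2 L.isHeytingFrame.bot_mem⟩
  himp_bot _ := rfl

/-- The ideals of the compact elements of a Heyting frame correspond to its elements. -/
noncomputable def idealOrderIso (L : HeytFrmStar.{u}) :
    Order.Ideal {a : L // IsCompactElement a} ≃o L :=
  OrderIso.ofSurjective
    (OrderEmbedding.ofMapLEIff (fun I => sSup (Subtype.val '' (I : Set {a : L // IsCompactElement a})))
      fun I J => by
        refine ⟨fun h a ha => ?_, fun h => sSup_le_sSup (Set.image_mono h)⟩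
        -- A compact element below the directed join of `J` is below a member of `J`, so the join
        -- determines the ideal.
        obtain ⟨_, ⟨b, hb, rfl⟩, hab⟩ :=
          (CompleteLattice.isCompactElement_iff_le_of_directed_sSup_le _ a.1).1 a.2
            (Subtype.val '' (J : Set {a : L // IsCompactElement a})) (J.nonempty.image _)
            (by
              rintro _ ⟨b, hb, rfl⟩ _ ⟨c, hc, rfl⟩
              exact ⟨_, ⟨b ⊔ c, J.sup_mem hb hc, rfl⟩, le_sup_left (b := (c : L)),
                le_sup_right (a := (b : L))⟩)
            (le_trans (le_sSup (Set.mem_image_of_mem _ ha)) h)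
        exact J.lower hab hb)
    fun l => by
      have := L.isHeytingFrame.algebraic
      -- The compact elements below `l`; their join is `l` by algebraicity.
      let I : Order.Ideal {a : L // IsCompactElement a} :=
        { carrier := {a | (a : L) ≤ l}
          lower' := fun a b hba ha => le_trans (Subtype.coe_le_coe.2 hba) ha
          nonempty' := ⟨⊥, bot_le (α := L)⟩
          directed' := fun a ha b hb => ⟨a ⊔ b, sup_le (α := L) ha hb, le_sup_left, le_sup_right⟩ }
      refine ⟨I, ?_⟩
      refine Eq.trans (congrArg sSup ?_) (sSup_compact_le_eq l)
      ext a
      exact ⟨fun ⟨b, hb, h⟩ => h ▸ ⟨b.2, hb⟩, fun ha => ⟨⟨a, ha.1⟩, ha.2, rfl⟩⟩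

theorem idealOrderIso_apply (L : HeytFrmStar.{u}) (I : Order.Ideal {a : L // IsCompactElement a}) :
    idealOrderIso L I = sSup (Subtype.val '' (I : Set {a : L // IsCompactElement a})) := rfl

theorem idealOrderIso_principal (L : HeytFrmStar.{u}) (a : {a : L // IsCompactElement a}) :
    idealOrderIso L (Order.Ideal.principal a) = a := by
  rw [idealOrderIso_apply]
  apply IsGreatest.csSup_eq
  exact ⟨⟨a, le_rfl, rfl⟩, fun _ ⟨b, hb, h⟩ => h ▸ hb⟩

/-- The restriction of a morphism of Heyting frames to compact elements. -/
def restrictCompact (α : L ⟶ M) :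
    BoundedLatticeHom {a : L // IsCompactElement a} {a : M // IsCompactElement a} where
  toFun a := ⟨α.hom a, α.map_compact a a.2⟩
  map_sup' a b := Subtype.ext (map_sup α.hom (a : L) b)
  map_inf' a b := Subtype.ext (map_inf α.hom (a : L) b)
  map_top' := Subtype.ext (map_top α.hom)
  map_bot' := Subtype.ext (map_bot α.hom)

/-- Naturality of `idealOrderIso`: preservation of joins and meets passes from `α` to `h*`. -/
theorem idealOrderIso_idealMap (α : L ⟶ M) (I : Order.Ideal {a : L // IsCompactElement a}) :
    idealOrderIso M (idealMap (restrictCompact α) I) = α.hom (idealOrderIso L I) := by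
  rw [idealOrderIso_apply, idealOrderIso_apply, map_sSup]
  apply le_antisymm
  · apply sSup_le
    rintro _ ⟨b, ⟨a, ha, hb⟩, rfl⟩
    exact le_trans (Subtype.coe_le_coe.2 hb) (le_sSup ⟨a, ⟨a, ha, rfl⟩, rfl⟩)
  · apply sSup_le_sSup
    rintro _ ⟨_, ⟨a, ha, rfl⟩, rfl⟩
    exact ⟨restrictCompact α a, ⟨a, ha, le_rfl⟩, rfl⟩

/-- The functor of compact elements. -/
def compactFunctor : HeytFrmStar.{u} ⥤ HAStar.{u} where
  obj L := ⟨{a : L // IsCompactElement a}⟩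
  map {L M} α :=
    { hom := restrictCompact α
      map_sSup := fun S => (idealOrderIso M).injective <| by
        simp only [idealOrderIso_idealMap, map_sSup, Set.image_image]
      map_sInf := fun S => (idealOrderIso M).injective <| by
        simp only [idealOrderIso_idealMap, map_sInf, Set.image_image] }

instance : compactFunctor.{u}.Faithful where
  map_injective {L M α β} h := by
    have := L.isHeytingFrame.algebraic
    have hc : ∀ a : L, IsCompactElement a → α.hom a = β.hom a := fun a ha =>
      congrArg Subtype.val (DFunLike.congr_fun (congrArg HAStar.Hom.hom h) (⟨a, ha⟩ : {a : L // _}))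
    refine Hom.ext (DFunLike.ext _ _ fun a => ?_)
    obtain ⟨s, hs, rfl⟩ := IsCompactlyGenerated.exists_sSup_eq a
    rw [map_sSup, map_sSup, Set.image_congr fun a ha => hc a (hs a ha)]

instance : compactFunctor.{u}.Full where
  map_surjective {L M} h := by
    let H : CompleteLatticeHom (Order.Ideal {a : L // IsCompactElement a})
        (Order.Ideal {a : M // IsCompactElement a}) :=
      ⟨⟨idealMap h.hom, h.map_sInf⟩, h.map_sSup⟩
    -- The extension of `h` is `h*` conjugated by `idealOrderIso`; it agrees with `h` on compact
    -- elements because `h*` sends `↓a` to `↓(h a)`.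
    let α : CompleteLatticeHom L M := CompleteLatticeHom.comp (idealOrderIso M : CompleteLatticeHom _ M)
      (H.comp ((idealOrderIso L).symm : CompleteLatticeHom L _))
    have key (a : {a : L // IsCompactElement a}) : α a = Subtype.val (h.hom a) := by
      have h1 : (idealOrderIso L).symm a = Order.Ideal.principal a :=
        (idealOrderIso L).symm_apply_eq.2 (idealOrderIso_principal L a).symm
      have h2 : idealMap h.hom (Order.Ideal.principal a) = Order.Ideal.principal (h.hom a) := by
        ext b
        exact ⟨fun ⟨c, hc, hb⟩ => hb.trans (OrderHomClass.mono h.hom hc),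
          fun hb => ⟨a, le_rfl, hb⟩⟩
      change idealOrderIso M (idealMap h.hom ((idealOrderIso L).symm a)) = _
      rw [h1]
      exact (congrArg _ h2).trans (idealOrderIso_principal M _)
    refine ⟨⟨α, fun a ha => ?_⟩, HAStar.Hom.ext (DFunLike.ext _ _ fun a => Subtype.ext (key a))⟩
    rw [key ⟨a, ha⟩]
    exact Subtype.prop _

end HeytFrmStar

/-- The action of an order isomorphism on ideals. -/
def idealMapOrderIso {A B : Type u} [HeytingAlgebra A] [HeytingAlgebra B] (e : A ≃o B) :
    Order.Ideal A ≃o Order.Ideal B where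
  toFun := idealMap (e : BoundedLatticeHom A B)
  invFun := idealMap (e.symm : BoundedLatticeHom B A)
  left_inv I := by
    rw [← idealMap_comp]
    convert idealMap_id I
    ext; simp
  right_inv I := by
    rw [← idealMap_comp]
    convert idealMap_id I
    ext; simp
  map_rel_iff' {I J} := by
    constructor
    · intro h a ha
      obtain ⟨b, hb, hab⟩ := h (x := e a) ⟨a, ha, le_rfl⟩
      exact J.lower (e.le_iff_le.1 hab) hb
    · rintro h _ ⟨a, ha, hb⟩
      exact ⟨a, h ha, hb⟩

namespace HAStar

variable {A B : HAStar.{u}}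

/-- An order isomorphism of Heyting algebras as a morphism of `HA*`. -/
def homOfOrderIso (e : A ≃o B) : A ⟶ B where
  hom := (e : BoundedLatticeHom A B)
  map_sSup S := map_sSup (idealMapOrderIso e) S
  map_sInf S := map_sInf (idealMapOrderIso e) S

/-- Order isomorphisms of Heyting algebras are isomorphisms in `HA*`. -/
def isoOfOrderIso (e : A ≃o B) : A ≅ B where
  hom := homOfOrderIso e
  inv := homOfOrderIso e.symm
  hom_inv_id := Hom.ext (DFunLike.ext _ _ fun a => e.symm_apply_apply a)
  inv_hom_id := Hom.ext (DFunLike.ext _ _ fun a => e.apply_symm_apply a)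

end HAStar

instance : HeytFrmStar.compactFunctor.{u}.EssSurj where
  mem_essImage A := ⟨HeytFrmStar.ofIdeals A,
    ⟨(HAStar.isoOfOrderIso (B := HeytFrmStar.compactFunctor.obj (HeytFrmStar.ofIdeals A))
      (principalOrderIso A)).symm⟩⟩

instance : HeytFrmStar.compactFunctor.{u}.IsEquivalence where

/-! ### Separation in compact ordered spaces -/

section Separation

variable {X : Type u} [TopologicalSpace X]

/-- The compactness argument behind all separation results below: if a family closed under finite
intersections separates `x` from each point of `C`, finitely many members separate it from all of
`C`. -/
theorem exists_mem_disjoint_of_isClosed [CompactSpace X] {B : Set (Set X)}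
    (hB : ∀ U ∈ B, IsClosed U) (huniv : Set.univ ∈ B)
    (hinter : ∀ U ∈ B, ∀ V ∈ B, U ∩ V ∈ B) {C : Set X} (hC : IsClosed C) {x : X}
    (h : ∀ c ∈ C, ∃ U ∈ B, x ∈ U ∧ c ∉ U) : ∃ U ∈ B, x ∈ U ∧ Disjoint U C := by
  refine hC.isCompact.induction_on (p := fun s => ∃ U ∈ B, x ∈ U ∧ Disjoint U s)
    ⟨_, huniv, trivial, Set.disjoint_empty _⟩ ?_ ?_ ?_
  · rintro s t hst ⟨U, hU, hx, hd⟩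
    exact ⟨U, hU, hx, hd.mono_right hst⟩
  · rintro s t ⟨U, hU, hx, hd⟩ ⟨V, hV, hx', hd'⟩
    exact ⟨U ∩ V, hinter U hU V hV, ⟨hx, hx'⟩, Set.disjoint_union_right.2
      ⟨hd.mono_left Set.inter_subset_left, hd'.mono_left Set.inter_subset_right⟩⟩
  · intro c hc
    obtain ⟨U, hU, hx, hcU⟩ := h c hc
    exact ⟨Uᶜ, mem_nhdsWithin_of_mem_nhds ((hB U hU).isOpen_compl.mem_nhds hcU), U, hU, hx,
      disjoint_compl_right⟩

variable [PartialOrder X]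

theorem exists_isClopen_upper_disjoint [CompactSpace X] [PriestleySpace X] {C : Set X}
    (hC : IsClosed C) {x : X} (h : ∀ c ∈ C, ¬ x ≤ c) :
    ∃ U : Set X, (IsClopen U ∧ IsUpperSet U) ∧ x ∈ U ∧ Disjoint U C :=
  exists_mem_disjoint_of_isClosed (B := {U | IsClopen U ∧ IsUpperSet U})
    (fun _ hU => hU.1.isClosed) ⟨isClopen_univ, isUpperSet_univ⟩
    (fun _ hU _ hV => ⟨hU.1.inter hV.1, hU.2.inter hV.2⟩) hC fun c hc => by
      obtain ⟨U, h1, h2, h3⟩ := exists_isClopen_upper_of_not_le (h c hc)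
      exact ⟨U, ⟨h1, h2⟩, h3⟩

theorem IsClosed.lowerClosure_of_priestleySpace [CompactSpace X] [PriestleySpace X] {C : Set X}
    (hC : IsClosed C) : IsClosed (lowerClosure C : Set X) := by
  rw [← isOpen_compl_iff, isOpen_iff_forall_mem_open]
  intro x hx
  obtain ⟨U, ⟨hU, hup⟩, hxU, hd⟩ := exists_isClopen_upper_disjoint hC
    (x := x) fun c hc hxc => hx ⟨c, hc, hxc⟩
  refine ⟨U, ?_, hU.isOpen, hxU⟩
  rintro y hy ⟨c, hc, hyc⟩
  exact Set.disjoint_left.1 hd (hup hyc hy) hc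

theorem exists_isClopen_upper_subset [CompactSpace X] [PriestleySpace X] {U : Set X}
    (hU : IsOpen U) (hup : IsUpperSet U) {x : X} (hx : x ∈ U) :
    ∃ V : Set X, (IsClopen V ∧ IsUpperSet V) ∧ x ∈ V ∧ V ⊆ U := by
  obtain ⟨V, hV, hxV, hd⟩ := exists_isClopen_upper_disjoint hU.isClosed_compl
    (x := x) fun c hc hxc => hc (hup hxc hx)
  exact ⟨V, hV, hxV, Set.disjoint_compl_right_iff_subset.1 hd⟩

/-- Clopen upsets and their complements separate points, and the clopen sets with clopen preimage
are closed under intersection, so they give neighbourhoods inside any open set. -/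
theorem continuous_of_isClopen_preimage_upper {X : Type u} {Y : Type v} [TopologicalSpace X]
    [PartialOrder Y] [TopologicalSpace Y] [CompactSpace Y] [PriestleySpace Y] {f : X → Y}
    (hf : ∀ U : Set Y, IsClopen U → IsUpperSet U → IsClopen (f ⁻¹' U)) : Continuous f := by
  rw [continuous_def]
  intro O hO
  rw [isOpen_iff_forall_mem_open]
  intro x hx
  obtain ⟨U, ⟨hU, hfU⟩, hxU, hd⟩ := exists_mem_disjoint_of_isClosed
    (B := {U : Set Y | IsClopen U ∧ IsClopen (f ⁻¹' U)}) (fun _ hU => hU.1.isClosed)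
    ⟨isClopen_univ, isClopen_univ⟩ (fun _ hU _ hV => ⟨hU.1.inter hV.1, hU.2.inter hV.2⟩)
    hO.isClosed_compl (x := f x) fun c hc => by
      have hne : f x ≠ c := fun h => hc (h ▸ hx)
      obtain ⟨U, hU, hup | hlow, hxU, hcU⟩ := exists_isClopen_upper_or_lower_of_ne hne
      · exact ⟨U, ⟨hU, hf U hU hup⟩, hxU, hcU⟩
      · exact ⟨U, ⟨hU, by simpa using (hf _ hU.compl hlow.compl).compl⟩, hxU, hcU⟩
  exact ⟨f ⁻¹' U, Set.preimage_mono (Set.disjoint_compl_right_iff_subset.1 hd), hfU.isOpen, hxU⟩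

end Separation

/-! ### The frame of open upsets -/

namespace OpUp

variable {X : Type u} {Y : Type v} [PartialOrder X] [TopologicalSpace X]
  [PartialOrder Y] [TopologicalSpace Y]

theorem le_iff {U V : OpUp X} : U ≤ V ↔ U.1 ⊆ V.1 := Iff.rfl

theorem coe_sSup (S : Set (OpUp X)) : (sSup S).1 = ⋃ U ∈ S, U.1 := rfl

theorem mem_sSup {S : Set (OpUp X)} {x : X} : x ∈ (sSup S).1 ↔ ∃ U ∈ S, x ∈ U.1 := by
  simp [coe_sSup]

theorem coe_inf (U V : OpUp X) : (U ⊓ V).1 = U.1 ∩ V.1 := by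
  let W : OpUp X := ⟨U.1 ∩ V.1, U.2.1.inter V.2.1, U.2.2.inter V.2.2⟩
  have h : U ⊓ V = W := le_antisymm
    (le_iff.2 (Set.subset_inter (le_iff.1 inf_le_left) (le_iff.1 inf_le_right)))
    (le_inf (le_iff.2 Set.inter_subset_left) (le_iff.2 Set.inter_subset_right))
  rw [h]

theorem coe_sup (U V : OpUp X) : (U ⊔ V).1 = U.1 ∪ V.1 := by
  rw [← sSup_pair]
  ext x
  rw [mem_sSup]
  simp only [Set.mem_insert_iff, Set.mem_singleton_iff, exists_eq_or_imp, exists_eq_left]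
  rfl

theorem coe_bot : (⊥ : OpUp X).1 = ∅ := by
  rw [← sSup_empty, Set.eq_empty_iff_forall_notMem]
  intro x hx
  obtain ⟨_, h, _⟩ := mem_sSup.1 hx
  exact h

theorem coe_top : (⊤ : OpUp X).1 = Set.univ := by
  let W : OpUp X := ⟨Set.univ, isOpen_univ, isUpperSet_univ⟩
  have h : (⊤ : OpUp X) = W := le_antisymm (le_iff.2 (Set.subset_univ _)) le_top
  rw [h]

/-- In a Priestley space the downset of a closed set is closed, so `↓ cl` yields the least closed
downset containing a given set. -/
theorem coe_sInf [CompactSpace X] [PriestleySpace X] (S : Set (OpUp X)) :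
    (sInf S).1 = (lowerClosure (closure (⋂ U ∈ S, U.1)ᶜ) : Set X)ᶜ := by
  let W : OpUp X := ⟨(lowerClosure (closure (⋂ U ∈ S, U.1)ᶜ) : Set X)ᶜ,
    isClosed_closure.lowerClosure_of_priestleySpace.isOpen_compl, (LowerSet.lower _).compl⟩
  suffices h : sInf S = W by rw [h]
  apply le_antisymm
  · rw [le_iff, Set.subset_compl_comm]
    refine lowerClosure_min (closure_minimal ?_ (sInf S).2.1.isClosed_compl) (sInf S).2.2.compl
    exact Set.compl_subset_compl.2 (Set.subset_iInter₂ fun U hU => le_iff.1 (sInf_le hU))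
  · refine le_sInf fun U hU => le_iff.2 ?_
    rw [Set.compl_subset_comm]
    exact Set.Subset.trans (Set.compl_subset_compl.2 (Set.biInter_subset_of_mem hU))
      (subset_closure.trans subset_lowerClosure)

theorem preimage_sSup (f : X →Co Y) (S : Set (OpUp Y)) :
    preimage f (sSup S) = sSup (preimage f '' S) := by
  apply Subtype.ext
  ext x
  rw [mem_sSup, Set.exists_mem_image]
  exact mem_sSup

theorem preimage_sInf_iff [CompactSpace X] [PriestleySpace X] [CompactSpace Y] [PriestleySpace Y]
    (f : X →Co Y) :
    (∀ S : Set (OpUp Y), preimage f (sInf S) = sInf (preimage f '' S)) ↔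
      PreservesDownClosure f := by
  have key (S : Set (OpUp Y)) : preimage f (sInf S) = sInf (preimage f '' S) ↔
      f ⁻¹' (lowerClosure (closure (⋂ U ∈ S, U.1)ᶜ) : Set Y) =
        (lowerClosure (closure (f ⁻¹' (⋂ U ∈ S, U.1)ᶜ)) : Set X) := by
    refine Subtype.ext_iff.trans ?_
    change f ⁻¹' (sInf S).1 = (sInf (preimage f '' S)).1 ↔ _
    rw [coe_sInf, coe_sInf, Set.preimage_compl, compl_inj_iff]
    have h : (⋂ U ∈ preimage f '' S, U.1) = f ⁻¹' ⋂ U ∈ S, U.1 := by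
      rw [Set.biInter_image, Set.preimage_iInter₂]
      rfl
    rw [h, Set.preimage_compl]
  constructor
  · intro h D hD
    -- A downset is the union of the sets `↓d`, each closed, so its complement is an intersection of
    -- open upsets.
    let S : Set (OpUp Y) := {U | ∃ d ∈ D, U.1 = (lowerClosure {d} : Set Y)ᶜ}
    have hS : (⋂ U ∈ S, U.1)ᶜ = D := by
      apply Set.Subset.antisymm
      · rw [Set.compl_subset_comm]
        refine Set.subset_iInter₂ ?_
        rintro U ⟨d, hd, hU⟩
        rw [hU]
        exact Set.compl_subset_compl.2 (lowerClosure_min (Set.singleton_subset_iff.2 hd) hD)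
      · intro d hd hd'
        have h := Set.mem_iInter₂.1 hd' ⟨(lowerClosure {d} : Set Y)ᶜ,
          isClosed_singleton.lowerClosure_of_priestleySpace.isOpen_compl,
          (LowerSet.lower _).compl⟩ ⟨d, hd, rfl⟩
        exact h (subset_lowerClosure rfl)
    have := (key S).1 (h S)
    rwa [hS] at this
  · intro h S
    rw [key]
    refine h _ (IsUpperSet.compl ?_)
    exact isUpperSet_iInter₂ fun U _ => U.2.2

instance : Order.Frame (OpUp X) :=
  Order.Frame.ofMinimalAxioms ⟨fun U S => by
    rw [le_iff]
    intro x hx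
    rw [coe_inf] at hx
    obtain ⟨V, hV, hxV⟩ := mem_sSup.1 hx.2
    refine le_iff.1 (le_biSup (fun V => U ⊓ V) hV) ?_
    rw [coe_inf]
    exact ⟨hx.1, hxV⟩⟩

theorem sSup_isClosed_le [CompactSpace X] [PriestleySpace X] (U : OpUp X) :
    sSup {V | IsClosed V.1 ∧ V ≤ U} = U := by
  refine le_antisymm (sSup_le fun V hV => hV.2) ?_
  rw [le_iff]
  intro x hx
  obtain ⟨V, hV, hxV, hVU⟩ := exists_isClopen_upper_subset U.2.1 U.2.2 hx
  exact mem_sSup.2 ⟨⟨V, hV.1.isOpen, hV.2⟩, ⟨hV.1.isClosed, hVU⟩, hxV⟩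

/-- An open upset is the directed union of its clopen sub-upsets, so a compact one is clopen;
conversely closed subsets of a compact space are compact. -/
theorem isCompactElement_iff [CompactSpace X] [PriestleySpace X] {U : OpUp X} :
    IsCompactElement U ↔ IsClosed U.1 := by
  rw [CompleteLattice.isCompactElement_iff_le_of_directed_sSup_le]
  constructor
  · intro h
    obtain ⟨V, hV, hUV⟩ := h {V | IsClosed V.1 ∧ V ≤ U} ⟨⊥, by simp [coe_bot]⟩
      (fun V hV W hW => ⟨V ⊔ W, ⟨by rw [coe_sup]; exact hV.1.union hW.1, sup_le hV.2 hW.2⟩,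
        le_sup_left, le_sup_right⟩) (sSup_isClosed_le U).ge
    rw [le_antisymm hUV hV.2]
    exact hV.1
  · intro h S hne hd hS
    have := hne.to_subtype
    obtain ⟨V, hV⟩ := h.isCompact.elim_directed_cover (fun V : S => V.1.1) (fun V => V.1.2.1)
      (fun x hx => by
        obtain ⟨V, hV, hxV⟩ := mem_sSup.1 (hS hx)
        exact Set.mem_iUnion.2 ⟨⟨V, hV⟩, hxV⟩)
      hd.directed_val
    exact ⟨V, V.2, hV⟩

theorem coe_himp_of_isClosed {U V : OpUp X} (h : IsClosed (lowerClosure (U.1 \ V.1) : Set X)) :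
    (U ⇨ V).1 = (lowerClosure (U.1 \ V.1) : Set X)ᶜ := by
  let W : OpUp X := ⟨(lowerClosure (U.1 \ V.1) : Set X)ᶜ, h.isOpen_compl,
    (LowerSet.lower _).compl⟩
  suffices h : U ⇨ V = W by rw [h]
  apply le_antisymm
  · rw [le_iff, Set.subset_compl_comm]
    refine lowerClosure_min ?_ (U ⇨ V).2.2.compl
    rintro x ⟨hxU, hxV⟩ hx
    refine hxV (le_iff.1 (himp_inf_le (a := U) (b := V)) ?_)
    rw [coe_inf]
    exact ⟨hx, hxU⟩
  · rw [le_himp_iff, le_iff, coe_inf]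
    rintro x ⟨hx, hxU⟩
    by_contra hxV
    exact hx (subset_lowerClosure ⟨hxU, hxV⟩)

theorem isHeytingFrame (X : ESStar.{u}) : IsHeytingFrame (OpUp X) where
  algebraic := ⟨fun U => ⟨_, fun _ hV => isCompactElement_iff.2 hV.1, sSup_isClosed_le U⟩⟩
  bot_mem := isCompactElement_iff.2 (by simp [coe_bot])
  top_mem := isCompactElement_iff.2 (by simp [coe_top])
  sup_mem U V := by
    simp only [isCompactElement_iff, coe_sup]
    exact IsClosed.union
  inf_mem U V := by
    simp only [isCompactElement_iff, coe_inf]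
    exact IsClosed.inter
  himp_mem U V := by
    simp only [isCompactElement_iff]
    intro hU hV
    have h := X.isClopen_lowerClosure (U.1 \ V.1) (IsClopen.diff ⟨hU, U.2.1⟩ ⟨hV, V.2.1⟩)
    rw [coe_himp_of_isClosed h.isClosed]
    exact h.isOpen.isClosed_compl

/-- A complete lattice homomorphism of open upsets is pointwise the inverse image along a map of
points. -/
theorem exists_point [CompactSpace Y] [PriestleySpace Y] (α : CompleteLatticeHom (OpUp Y) (OpUp X))
    (x : X) : ∃ y : Y, ∀ U : OpUp Y, y ∈ U.1 ↔ x ∈ (α U).1 := by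
  -- The largest open upset whose image misses `x`. The point sought lies outside `W` and in every
  -- clopen upset whose image contains `x`.
  let W : OpUp Y := sSup {U | x ∉ (α U).1}
  have hW : x ∉ (α W).1 := by
    rw [map_sSup, mem_sSup]
    rintro ⟨_, ⟨U, hU, rfl⟩, hx⟩
    exact hU hx
  have hmono {U V : OpUp Y} (h : U ≤ V) (hx : x ∈ (α U).1) : x ∈ (α V).1 :=
    le_iff.1 (OrderHomClass.mono α h) hx
  let T : Set (Set Y) := {C | ∃ U : OpUp Y, IsClosed U.1 ∧ x ∈ (α U).1 ∧ C = U.1 \ W.1}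
  have hT : ∀ C ∈ T, IsClosed C := by
    rintro _ ⟨U, hU, _, rfl⟩
    exact hU.sdiff W.2.1
  obtain ⟨y, hy⟩ : (⋂₀ T).Nonempty := by
    have hne : T.Nonempty := ⟨_, ⊤, by simp [coe_top], by simp [coe_top], rfl⟩
    refine IsCompact.nonempty_sInter_of_directed_nonempty_isCompact_isClosed (hS := hne.to_subtype) ?_ ?_
      (fun C hC => (hT C hC).isCompact) hT
    · rintro _ ⟨U, hU, hxU, rfl⟩ _ ⟨V, hV, hxV, rfl⟩
      refine ⟨_, ⟨U ⊓ V, ?_, ?_, rfl⟩, ?_, ?_⟩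
      · rw [coe_inf]
        exact hU.inter hV
      · rw [map_inf, coe_inf]
        exact ⟨hxU, hxV⟩
      · exact Set.sdiff_subset_sdiff_left (le_iff.1 inf_le_left)
      · exact Set.sdiff_subset_sdiff_left (le_iff.1 inf_le_right)
    · rintro _ ⟨U, hU, hxU, rfl⟩
      -- If `U ⊆ W`, monotonicity would put `x` in `α W`.
      exact Set.sdiff_nonempty.2 fun h => hW (hmono h hxU)
  refine ⟨y, fun U => ⟨fun hyU => ?_, fun hxU => ?_⟩⟩
  · by_contra hxU
    have hyW : y ∉ W.1 := (hy _ ⟨⊤, by simp [coe_top], by simp [coe_top], rfl⟩).2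
    exact hyW (mem_sSup.2 ⟨U, hxU, hyU⟩)
  · rw [← sSup_isClosed_le U, map_sSup, mem_sSup] at hxU
    obtain ⟨_, ⟨V, hV, rfl⟩, hxV⟩ := hxU
    exact hV.2 (hy _ ⟨V, hV.1, hxV, rfl⟩).1

/-- Preservation of compact elements makes preimages of clopen upsets clopen, hence the point map
continuous; it is monotone since each `α U` is an upset. -/
theorem exists_preimage_eq [CompactSpace X] [PriestleySpace X] [CompactSpace Y] [PriestleySpace Y]
    (α : CompleteLatticeHom (OpUp Y) (OpUp X))
    (hα : ∀ U, IsCompactElement U → IsCompactElement (α U)) :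
    ∃ f : X →Co Y, ∀ U, preimage f U = α U := by
  choose f hf using exists_point α
  have hpre (U : OpUp Y) : f ⁻¹' U.1 = (α U).1 := Set.ext fun x => hf x U
  have hc : Continuous f := continuous_of_isClopen_preimage_upper fun U hU hup => by
    have h := hpre ⟨U, hU.isOpen, hup⟩
    change f ⁻¹' U = _ at h
    rw [h]
    exact ⟨isCompactElement_iff.1 (hα _ (isCompactElement_iff.2 hU.isClosed)), (α _).2.1⟩
  have hm : Monotone f := fun x x' hx => by
    by_contra hle
    obtain ⟨U, hU, hup, hxU, hxU'⟩ := exists_isClopen_upper_of_not_le hle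
    let V : OpUp Y := ⟨U, hU.isOpen, hup⟩
    exact hxU' ((hf x' V).2 ((α V).2.2 hx ((hf x V).1 hxU)))
  exact ⟨⟨⟨f, hm⟩, hc⟩, fun U => Subtype.ext (hpre U)⟩

end OpUp

/-! ### The open upset functor -/

namespace ESStar

/-- The contravariant functor of open upsets. -/
def opUpFunctor : ESStar.{u}ᵒᵖ ⥤ HeytFrmStar.{u} where
  obj X := ⟨OpUp X.unop, OpUp.isHeytingFrame X.unop⟩
  map {X Y} f :=
    { hom :=
        { toFun := OpUp.preimage f.unop.hom
          map_sInf' := (OpUp.preimage_sInf_iff f.unop.hom).2 f.unop.preserves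
          map_sSup' := OpUp.preimage_sSup f.unop.hom }
      map_compact := fun U hU => OpUp.isCompactElement_iff.2
        ((OpUp.isCompactElement_iff.1 hU).preimage (map_continuous f.unop.hom)) }

theorem hom_le_of_preimage_eq {X Y : ESStar.{u}} {f g : X ⟶ Y}
    (h : ∀ U, OpUp.preimage f.hom U = OpUp.preimage g.hom U) (x : X) : f.hom x ≤ g.hom x := by
  by_contra hle
  obtain ⟨U, hU, hup, hxU, hxU'⟩ := exists_isClopen_upper_of_not_le hle
  exact hxU' ((Set.ext_iff.1 (congrArg Subtype.val (h ⟨U, hU.isOpen, hup⟩)) x).1 hxU)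

instance : opUpFunctor.{u}.Faithful where
  map_injective {X Y f g} h := by
    have h' (U : OpUp X.unop) : OpUp.preimage f.unop.hom U = OpUp.preimage g.unop.hom U :=
      DFunLike.congr_fun (congrArg HeytFrmStar.Hom.hom h) U
    exact Quiver.Hom.unop_inj (Hom.ext (DFunLike.ext _ _ fun x =>
      le_antisymm (hom_le_of_preimage_eq h' x) (hom_le_of_preimage_eq (fun U => (h' U).symm) x)))

instance : opUpFunctor.{u}.Full where
  map_surjective {X Y} α := by
    obtain ⟨f, hf⟩ := OpUp.exists_preimage_eq (X := Y.unop) (Y := X.unop) α.hom α.map_compact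
    refine ⟨Quiver.Hom.op (X := Y.unop) (Y := X.unop)
      ⟨f, (OpUp.preimage_sInf_iff f).1 fun S => ?_⟩, HeytFrmStar.Hom.ext (DFunLike.ext _ _ hf)⟩
    rw [hf, funext hf]
    exact α.hom.map_sInf' S

end ESStar

/-! ### The Esakia space of a Heyting algebra -/

/-- The prime filters of a bounded lattice, as two-valued homomorphisms. -/
def LatticeSpectrum (A : Type u) [Lattice A] [BoundedOrder A] : Type u :=
  {p : A → Bool // p ⊤ = true ∧ p ⊥ = false ∧
    ∀ a b, p (a ⊓ b) = (p a && p b) ∧ p (a ⊔ b) = (p a || p b)}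

namespace LatticeSpectrum

section Lattice

variable {A : Type u} [Lattice A] [BoundedOrder A]

instance : PartialOrder (LatticeSpectrum A) := inferInstanceAs (PartialOrder (Subtype _))

instance : TopologicalSpace (LatticeSpectrum A) :=
  inferInstanceAs (TopologicalSpace (Subtype _))

instance : CompactSpace (LatticeSpectrum A) := by
  refine isCompact_iff_compactSpace.1 (IsClosed.isCompact (X := A → Bool) ?_)
  have hc (a : A) : Continuous fun p : A → Bool => p a := continuous_apply a
  have hop {F : Bool → Bool → Bool} (a b : A) : Continuous fun p : A → Bool => F (p a) (p b) :=
    (continuous_of_discreteTopology (f := fun x : Bool × Bool => F x.1 x.2)).comp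
      ((hc a).prodMk (hc b))
  refine (isClosed_eq (hc ⊤) continuous_const).inter
    ((isClosed_eq (hc ⊥) continuous_const).inter ?_)
  have : {p : A → Bool | ∀ a b, p (a ⊓ b) = (p a && p b) ∧ p (a ⊔ b) = (p a || p b)} =
      ⋂ a, ⋂ b, {p | p (a ⊓ b) = (p a && p b)} ∩ {p | p (a ⊔ b) = (p a || p b)} := by
    ext p
    simp
  refine (congrArg IsClosed this).mpr (isClosed_iInter fun a => isClosed_iInter fun b =>
    (isClosed_eq (hc _) (hop a b)).inter (isClosed_eq (hc _) (hop a b)))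

/-- The prime filters containing a given element. -/
def basicUpper (a : A) : Set (LatticeSpectrum A) := {p | p.1 a = true}

theorem mem_basicUpper {a : A} {p : LatticeSpectrum A} :
    p ∈ basicUpper a ↔ p.1 a = true := Iff.rfl

theorem le_iff {p q : LatticeSpectrum A} :
    p ≤ q ↔ ∀ a, p ∈ basicUpper a → q ∈ basicUpper a := Iff.rfl

theorem isClopen_basicUpper (a : A) : IsClopen (basicUpper a) :=
  (isClopen_discrete {true}).preimage ((continuous_apply a).comp continuous_subtype_val)

theorem isUpperSet_basicUpper (a : A) : IsUpperSet (basicUpper a) := fun _ _ h hp => le_iff.1 h a hp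

theorem basicUpper_top : basicUpper (⊤ : A) = Set.univ := Set.eq_univ_of_forall fun p => p.2.1

theorem basicUpper_bot : basicUpper (⊥ : A) = ∅ :=
  Set.eq_empty_of_forall_notMem fun p hp => by simpa [p.2.2.1] using mem_basicUpper.1 hp

theorem basicUpper_inf (a b : A) : basicUpper (a ⊓ b) = basicUpper a ∩ basicUpper b := by
  ext p
  simp [mem_basicUpper, (p.2.2.2 a b).1]

theorem basicUpper_sup (a b : A) : basicUpper (a ⊔ b) = basicUpper a ∪ basicUpper b := by
  ext p
  simp [mem_basicUpper, (p.2.2.2 a b).2]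

theorem basicUpper_mono {a b : A} (h : a ≤ b) : basicUpper a ⊆ basicUpper b := by
  rw [← inf_eq_left.2 h, basicUpper_inf]
  exact Set.inter_subset_right

theorem exists_basicUpper_of_not_le {p q : LatticeSpectrum A} (h : ¬ p ≤ q) :
    ∃ a, p ∈ basicUpper a ∧ q ∉ basicUpper a := by
  simpa [le_iff] using h

instance : PriestleySpace (LatticeSpectrum A) where
  priestley h :=
    let ⟨a, hp, hq⟩ := exists_basicUpper_of_not_le h
    ⟨_, isClopen_basicUpper a, isUpperSet_basicUpper a, hp, hq⟩

theorem exists_basicUpper_subset {U : Set (LatticeSpectrum A)} (hU : IsOpen U)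
    (hup : IsUpperSet U) {p : LatticeSpectrum A} (hp : p ∈ U) :
    ∃ a, p ∈ basicUpper a ∧ basicUpper a ⊆ U := by
  obtain ⟨_, ⟨a, rfl⟩, hpa, hd⟩ := exists_mem_disjoint_of_isClosed
    (B := Set.range (basicUpper (A := A)))
    (by rintro _ ⟨a, rfl⟩; exact (isClopen_basicUpper a).isClosed) ⟨⊤, basicUpper_top⟩
    (by rintro _ ⟨a, rfl⟩ _ ⟨b, rfl⟩; exact ⟨_, basicUpper_inf a b⟩) hU.isClosed_compl (x := p)
    fun q hq => by
      obtain ⟨a, ha⟩ := exists_basicUpper_of_not_le fun h : p ≤ q => hq (hup h hp)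
      exact ⟨_, ⟨a, rfl⟩, ha⟩
  exact ⟨a, hpa, Set.disjoint_compl_right_iff_subset.1 hd⟩

theorem exists_basicUpper_diff_subset {U : Set (LatticeSpectrum A)} (hU : IsOpen U)
    {p : LatticeSpectrum A} (hp : p ∈ U) :
    ∃ a b, p ∈ basicUpper a \ basicUpper b ∧ basicUpper a \ basicUpper b ⊆ U := by
  obtain ⟨_, ⟨⟨a, b⟩, rfl⟩, hpa, hd⟩ := exists_mem_disjoint_of_isClosed
    (B := Set.range fun x : A × A => basicUpper x.1 \ basicUpper x.2)
    (by
      rintro _ ⟨x, rfl⟩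
      exact ((isClopen_basicUpper x.1).diff (isClopen_basicUpper x.2)).isClosed)
    ⟨(⊤, ⊥), by simp [basicUpper_top, basicUpper_bot]⟩
    (by
      rintro _ ⟨x, rfl⟩ _ ⟨y, rfl⟩
      refine ⟨(x.1 ⊓ y.1, x.2 ⊔ y.2), ?_⟩
      ext q
      simp only [basicUpper_inf, basicUpper_sup, Set.mem_sdiff, Set.mem_inter_iff, Set.mem_union]
      tauto) hU.isClosed_compl (x := p)
    fun q hq => by
      by_cases h : p ≤ q
      -- Here `p < q`, so only an element of `q` outside `p` can separate them.
      · obtain ⟨a, ha, ha'⟩ := exists_basicUpper_of_not_le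
          fun h' : q ≤ p => hq (le_antisymm h h' ▸ hp)
        exact ⟨_, ⟨(⊤, a), rfl⟩, ⟨p.2.1, ha'⟩, fun h => h.2 ha⟩
      · obtain ⟨a, ha, ha'⟩ := exists_basicUpper_of_not_le h
        refine ⟨_, ⟨(a, ⊥), rfl⟩, ⟨ha, ?_⟩, fun h => ha' h.1⟩
        simp [basicUpper_bot]
  exact ⟨a, b, hpa, Set.disjoint_compl_right_iff_subset.1 hd⟩

end Lattice

section Heyting

variable {A : Type u} [HeytingAlgebra A]

open Order

-- The prime ideal theorem, with the complement of the prime ideal as the prime filter.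
open Classical in
theorem exists_of_disjoint (F : PFilter A) (I : Ideal A)
    (h : Disjoint (F : Set A) (I : Set A)) :
    ∃ p : LatticeSpectrum A, (∀ a ∈ F, p ∈ basicUpper a) ∧ ∀ a ∈ I, p ∉ basicUpper a := by
  obtain ⟨J, hJ, hIJ, hFJ⟩ := DistribLattice.prime_ideal_of_disjoint_filter_ideal h
  refine ⟨⟨fun a => decide (a ∉ J), ?_, ?_, fun a b => ⟨?_, ?_⟩⟩, ?_, ?_⟩
  · simpa using hJ.toIsProper.top_notMem
  · simp
  · rw [← Bool.decide_and, decide_eq_decide, ← not_or, not_iff_not]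
    exact ⟨hJ.mem_or_mem, fun h => h.elim (J.lower inf_le_left) (J.lower inf_le_right)⟩
  · rw [← Bool.decide_or, decide_eq_decide, Ideal.sup_mem_iff]
    tauto
  · intro a ha
    exact decide_eq_true (Set.disjoint_left.1 hFJ ha)
  · intro a ha
    exact fun h => of_decide_eq_true h (hIJ ha)

theorem lowerClosure_basicUpper_diff (a b : A) :
    (lowerClosure (basicUpper a \ basicUpper b) : Set (LatticeSpectrum A)) =
      (basicUpper (a ⇨ b))ᶜ := by
  apply Set.Subset.antisymm
  · refine lowerClosure_min (fun p hp hp' => hp.2 ?_) (isUpperSet_basicUpper _).compl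
    refine basicUpper_mono (himp_inf_le (a := a) (b := b)) ?_
    rw [basicUpper_inf]
    exact ⟨hp', hp.1⟩
  · intro q hq
    -- The filter generated by `q` and `a`. It avoids `b`, since `c ⊓ a ≤ b` with `c ∈ q` would
    -- force `a ⇨ b ∈ q`; a prime filter extending it and omitting `b` lies above `q`.
    have hF : IsPFilter {x | ∃ c, q ∈ basicUpper c ∧ c ⊓ a ≤ x} := by
      refine IsPFilter.of_def ⟨⊤, ⊤, q.2.1, le_top⟩ ?_ ?_
      · rintro x ⟨c, hc, hx⟩ y ⟨d, hd, hy⟩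
        refine ⟨x ⊓ y, ⟨c ⊓ d, ?_, ?_⟩, inf_le_left, inf_le_right⟩
        · rw [basicUpper_inf]
          exact ⟨hc, hd⟩
        · exact le_inf (le_trans (inf_le_inf_right a inf_le_left) hx)
            (le_trans (inf_le_inf_right a inf_le_right) hy)
      · rintro x y hxy ⟨c, hc, hx⟩
        exact ⟨c, hc, hx.trans hxy⟩
    obtain ⟨p, hpF, hpI⟩ := exists_of_disjoint hF.toPFilter (Ideal.principal b)
      (Set.disjoint_left.2 fun x ⟨c, hc, hx⟩ hxb =>
        hq (basicUpper_mono (le_himp_iff.2 (hx.trans hxb)) hc))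
    exact ⟨p, ⟨hpF a ⟨⊤, q.2.1, inf_le_right⟩, hpI b le_rfl⟩,
      le_iff.2 fun c hc => hpF c ⟨c, hc, inf_le_left⟩⟩

theorem isClopen_lowerClosure (U : Set (LatticeSpectrum A)) (hU : IsClopen U) :
    IsClopen (lowerClosure U : Set (LatticeSpectrum A)) := by
  refine ⟨hU.isClosed.lowerClosure_of_priestleySpace, isOpen_iff_forall_mem_open.2 ?_⟩
  rintro q ⟨p, hp, hqp⟩
  obtain ⟨a, b, hpab, hab⟩ := exists_basicUpper_diff_subset hU.isOpen hp
  refine ⟨_, lowerClosure_mono hab, ?_, ⟨p, hpab, hqp⟩⟩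
  rw [lowerClosure_basicUpper_diff]
  exact (isClopen_basicUpper _).compl.isOpen

/-- The open upset of prime filters meeting an ideal. -/
def ofIdeal (I : Ideal A) : OpUp (LatticeSpectrum A) :=
  ⟨⋃ a ∈ I, basicUpper a, isOpen_biUnion fun a _ => (isClopen_basicUpper a).isOpen,
    isUpperSet_iUnion₂ fun a _ => isUpperSet_basicUpper a⟩

theorem mem_ofIdeal {I : Ideal A} {p : LatticeSpectrum A} :
    p ∈ (ofIdeal I).1 ↔ ∃ a ∈ I, p ∈ basicUpper a := by
  simp [ofIdeal]

theorem ofIdeal_le_iff {I J : Ideal A} : ofIdeal I ≤ ofIdeal J ↔ I ≤ J := by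
  constructor
  · intro h a ha
    by_contra haJ
    obtain ⟨p, hpF, hpJ⟩ := exists_of_disjoint (PFilter.principal a) J
      (Set.disjoint_left.2 fun x hx hxJ => haJ (J.lower (PFilter.mem_principal.1 hx) hxJ))
    obtain ⟨b, hb, hpb⟩ := mem_ofIdeal.1
      (OpUp.le_iff.1 h (mem_ofIdeal.2 ⟨a, ha, hpF a (PFilter.mem_principal.2 le_rfl)⟩))
    exact hpJ b hb hpb
  · intro h p hp
    obtain ⟨a, ha, hpa⟩ := mem_ofIdeal.1 hp
    exact mem_ofIdeal.2 ⟨a, h ha, hpa⟩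

theorem ofIdeal_surjective : Function.Surjective (ofIdeal (A := A)) := by
  intro U
  -- The basic upsets inside `U` cover it, by compactness.
  let I : Ideal A :=
    { carrier := {a | basicUpper a ⊆ U.1}
      lower' := fun a b hba ha => (basicUpper_mono hba).trans ha
      nonempty' := ⟨⊥, by simp [basicUpper_bot]⟩
      directed' := fun a ha b hb => ⟨a ⊔ b, by
        simpa [basicUpper_sup] using And.intro ha hb, le_sup_left, le_sup_right⟩ }
  refine ⟨I, Subtype.ext (Set.ext fun p => mem_ofIdeal.trans ⟨?_, fun hp => ?_⟩)⟩
  · rintro ⟨a, ha, hpa⟩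
    exact ha hpa
  · obtain ⟨a, hpa, ha⟩ := exists_basicUpper_subset U.2.1 U.2.2 hp
    exact ⟨a, ha, hpa⟩

/-- Open upsets of the Esakia space of a Heyting algebra correspond to ideals. -/
noncomputable def idealOrderIsoOpUp (A : Type u) [HeytingAlgebra A] :
    Ideal A ≃o OpUp (LatticeSpectrum A) :=
  OrderIso.ofSurjective (OrderEmbedding.ofMapLEIff ofIdeal fun _ _ => ofIdeal_le_iff)
    ofIdeal_surjective

end Heyting

end LatticeSpectrum

/-! ### Esakia duality and the final theorem -/

namespace ESStar

/-- The Esakia space of prime filters of a Heyting algebra. -/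
def spectrum (A : Type u) [HeytingAlgebra A] : ESStar.{u} :=
  ⟨LatticeSpectrum A, LatticeSpectrum.isClopen_lowerClosure⟩

/-- Open upsets of the spectrum of `K(L)` match ideals of `K(L)`, which match elements of `L`. -/
instance : opUpFunctor.{u}.EssSurj where
  mem_essImage L := ⟨Opposite.op (spectrum {a : L // IsCompactElement a}),
    ⟨HeytFrmStar.isoOfOrderIso
      (L := opUpFunctor.obj (Opposite.op (spectrum {a : L // IsCompactElement a})))
      ((LatticeSpectrum.idealOrderIsoOpUp {a : L // IsCompactElement a}).symm.trans
        (HeytFrmStar.idealOrderIso L))⟩⟩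

instance : opUpFunctor.{u}.IsEquivalence where

end ESStar

theorem corollary3p18 :
    -- `HeytFrm*` is equivalent to `HA*`, via the functor of compact elements
    (∃ (e : HeytFrmStar.{u} ≌ HAStar.{u})
        (φ : ∀ L : HeytFrmStar.{u}, e.functor.obj L ≃o {a : L // IsCompactElement a}),
      ∀ (L M : HeytFrmStar.{u}) (α : L ⟶ M) (x : e.functor.obj L),
        (φ M ((e.functor.map α).hom x) : M) = α.hom (φ L x)) ∧
    -- `HeytFrm*` is dually equivalent to `ES*`, via the functor of open upsets
    (∃ (e : ESStar.{u}ᵒᵖ ≌ HeytFrmStar.{u})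
        (φ : ∀ X : ESStar.{u}, e.functor.obj (Opposite.op X) ≃o OpUp X),
      ∀ (X Y : ESStar.{u}) (f : X ⟶ Y) (x : e.functor.obj (Opposite.op Y)),
        φ X ((e.functor.map f.op).hom x) = OpUp.preimage f.hom (φ Y x)) ∧
    -- the morphism condition, for arbitrary Priestley spaces
    (∀ (X : Type v) (Y : Type w)
        [PartialOrder X] [TopologicalSpace X] [CompactSpace X] [PriestleySpace X]
        [PartialOrder Y] [TopologicalSpace Y] [CompactSpace Y] [PriestleySpace Y]
        (f : X →Co Y),
      (∀ S : Set (OpUp Y), OpUp.preimage f (sInf S) = sInf (OpUp.preimage f '' S)) ↔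
        PreservesDownClosure f) := by
  refine ⟨⟨HeytFrmStar.compactFunctor.asEquivalence,
      fun L => OrderIso.refl {a : L // IsCompactElement a}, fun _ _ _ _ => rfl⟩,
    ⟨ESStar.opUpFunctor.asEquivalence, fun X => OrderIso.refl (OpUp X), fun _ _ _ _ => rfl⟩, ?_⟩
  intro X Y _ _ _ _ _ _ _ _ f
  exact OpUp.preimage_sInf_iff f
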